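/- Let $A$ be a unital $C^*$-algebra and let $V$ be a Hilbert $A$-module, i.e. an $A$-module with a positive definite $A$-valued inner product $\langle\cdot,\cdot\rangle$ that is $A$-linear in the second variable and satisfies $\langle x,y\rangle=\langle y,x\rangle^*$, such that $V$ is complete for the norm $\|x\|=\|\langle x,x\rangle\|^{1/2}$. (It does not matter on which side $A$ acts, since right $A$-modules are the same as left modules over the opposite $C^*$-algebra.) Suppose that $V$ is countably generated: there is a sequence in $V$ whose finite $A$-linear combinations are norm-dense in $V$. Let $V'$ be the set of all bounded $A$-linear maps $V\to A$. Let $\tau_{V'}$ be the topology on $V$ generated by the seminorms $x\mapsto\|f(x)\|$, $f\in V'$, and let $\tau_{\widehat V}$ be the topology on $V$ generated by the seminorms $x\mapsto\|\langle z,x\rangle\|$, $z\in V$. If $\tau_{\widehat V}=\tau_{V'}$, then $V$ is self-dual: for every $f\in V'$ there is $x\in V$ such that $f(y)=\langle x,y\rangle$ for all $y\in V$. -/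

import Mathlib

namespace HilbertCStar

section

variable (A V : Type*) [CStarAlgebra A] [PartialOrder A] [StarOrderedRing A]
  [NormedAddCommGroup V] [NormedSpace ℂ V] [Module A V] [CStarModule A V]

/-- The scalar `c` acts on a Hilbert module in the same way as the element `c • 1` of `A`. -/
theorem smul_one_smul_eq (c : ℂ) (x : V) : (c • (1 : A)) • x = c • x := by
  have h : ∀ z : V, inner A z ((c • (1 : A)) • x - c • x) = 0 := fun z => by
    simp [CStarModule.inner_sub_right]
  exact sub_eq_zero.1 (CStarModule.inner_self.1 (h _))

variable {A V} in
/-- A bounded `A`-linear map `f : V → A`, regarded as a complex linear map. -/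
def toComplexLinear (f : V →L[A] A) : V →ₗ[ℂ] A where
  toFun x := f x
  map_add' x y := map_add f x y
  map_smul' c x := by
    rw [← smul_one_smul_eq A V c x, map_smul]
    simp

/-- The seminorms `ν_f (x) = ‖f x‖` on `V`, indexed by the elements `f` of the dual module `V'`,
the module of all bounded `A`-linear maps `V → A`. -/
noncomputable def dualSeminorms : SeminormFamily ℂ V (V →L[A] A) :=
  fun f => (normSeminorm ℂ A).comp (toComplexLinear f)

/-- The seminorms `μ_z (x) = ‖⟨z, x⟩‖` on `V`, indexed by the elements `z` of `V`. -/
noncomputable def hatSeminorms : SeminormFamily ℂ V V :=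
  fun z => (normSeminorm ℂ A).comp (CStarModule.innerₛₗ (A := A) z)

/-- The `V'`-weak module topology on `V`: the locally convex topology generated by the seminorms
`ν_f`, `f ∈ V'`. -/
noncomputable def tauDual : TopologicalSpace V :=
  (dualSeminorms A V).moduleFilterBasis.topology

/-- The `V̂`-weak module topology on `V`: the locally convex topology generated by the seminorms
`μ_z`, `z ∈ V`. -/
noncomputable def tauHat : TopologicalSpace V :=
  (hatSeminorms A V).moduleFilterBasis.topology

variable {V} in
/-- The element `x^ = ⟨x, ·⟩` of the dual module `V'`. -/
noncomputable def hat (x : V) : V →L[A] A where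
  toFun y := inner A x y
  map_add' _ _ := CStarModule.inner_add_right
  map_smul' _ _ := CStarModule.inner_op_smul_right
  cont := (CStarModule.innerSL (A := A) x).continuous

/-- `V` is self-dual: every bounded `A`-linear map `V → A` is of the form `⟨x, ·⟩`, `x ∈ V`. -/
def IsSelfDual : Prop :=
  Function.Surjective (hat A : V → (V →L[A] A))

/-- `V` is countably generated: the finite `A`-linear combinations of some sequence in `V` are
dense in norm. -/
def IsCountablyGenerated : Prop :=
  ∃ x : ℕ → V, Dense (Submodule.span A (Set.range x) : Set V)

end

end HilbertCStar

namespace HilbertCStar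

section

open CStarModule Filter Topology

variable {A V : Type*} [CStarAlgebra A] [PartialOrder A] [StarOrderedRing A]
  [NormedAddCommGroup V] [NormedSpace ℂ V] [Module A V] [CStarModule A V]

/-! Equality of the topologies bounds `‖f x‖` by finitely many `‖⟨z, x⟩‖`. For small `c > 0`, `S = c
∑ ⟨z, ·⟩ z` is a positive contraction, and the bound reads `‖f x‖² ≤ D ‖⟨x, S x⟩‖`. Put `T = 1 - S`.
As `f ∘ S` is represented by a vector, so is `f - f ∘ T^k`. Moreover `‖⟨T^k x, S T^k x⟩‖ ≤ ‖x‖² / k`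
(`norm_inner_pow_le`), so `f ∘ T^k → 0` in norm. Thus `f` is a norm limit of represented
functionals, and completeness of `V` makes it represented. -/

/-- If the seminorms `‖⟨z, ·⟩‖` and `‖f ·‖` generate the same topology, then each `‖f ·‖` is
dominated by finitely many of the seminorms `‖⟨z, ·⟩‖`. -/
theorem exists_bound_of_tauHat_eq_tauDual (htop : tauHat A V = tauDual A V) (f : V →L[A] A) :
    ∃ (s : Finset V) (C : ℝ), ∀ x, ‖f x‖ ≤ C * s.sup (hatSeminorms A V) x := by
  have hhat : @WithSeminorms ℂ V V _ _ _ (hatSeminorms A V) (tauHat A V) := by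
    let := tauHat A V
    exact ⟨rfl⟩
  have hdual : @WithSeminorms ℂ V (V →L[A] A) _ _ _ (dualSeminorms A V) (tauHat A V) := by
    let := tauHat A V
    exact ⟨htop⟩
  have hcont : Continuous[tauHat A V, _] (dualSeminorms A V f) := by
    let := tauHat A V
    exact hdual.continuous_seminorm f
  obtain ⟨s, C, -, hC⟩ : ∃ s : Finset V, ∃ C : NNReal, C ≠ 0 ∧
      dualSeminorms A V f ≤ C • s.sup (hatSeminorms A V) := by
    let := tauHat A V
    exact Seminorm.bound_of_continuous hhat _ hcont
  exact ⟨s, C, fun x => hC x⟩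

/-- A map `S` with `⟨x, S y⟩ = ⟨S x, y⟩` and `0 ≤ ⟨x, S x⟩ ≤ ⟨x, x⟩`. -/
structure IsPosContraction (A : Type*) {V : Type*} [CStarAlgebra A] [PartialOrder A]
    [NormedAddCommGroup V] [NormedSpace ℂ V] [Module A V] [CStarModule A V]
    (S : V →ₗ[ℂ] V) : Prop where
  symm : ∀ x y, inner A (S x) y = inner A x (S y)
  nonneg : ∀ x, 0 ≤ inner A x (S x)
  le_inner_self : ∀ x, inner A x (S x) ≤ inner A x x

namespace IsPosContraction

variable {S : V →ₗ[ℂ] V}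

/-- `S - S² = (1 - S) S (1 - S) + S (1 - S) S`, a sum of positive forms. -/
theorem inner_map_map_le (hS : IsPosContraction A S) (x : V) :
    inner A (S x) (S x) ≤ inner A x (S x) := by
  have h := add_le_add (hS.nonneg (x - S x)) (sub_nonneg.2 (hS.le_inner_self (S x)))
  simp only [map_sub, CStarModule.inner_sub_left, CStarModule.inner_sub_right, hS.symm] at h
  rw [hS.symm, ← sub_nonneg]
  convert h using 1 <;> abel

theorem inner_sub_map_self_le (hS : IsPosContraction A S) (x : V) :
    inner A (x - S x) (x - S x) + inner A x (S x) ≤ inner A x x := by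
  have h := hS.inner_map_map_le x
  rw [hS.symm] at h
  rw [← sub_nonneg] at h ⊢
  simp only [CStarModule.inner_sub_left, CStarModule.inner_sub_right, hS.symm]
  convert h using 1
  abel

/-- `S - (1 - S) S (1 - S) = S (1 - S) S + S²`. -/
theorem inner_sub_map_map_le (hS : IsPosContraction A S) (x : V) :
    inner A (x - S x) (S (x - S x)) ≤ inner A x (S x) := by
  have h := add_le_add (sub_nonneg.2 (hS.le_inner_self (S x)))
    (inner_self_nonneg (A := A) (x := S x))
  simp only [hS.symm] at h
  rw [← sub_nonneg]
  simp only [map_sub, CStarModule.inner_sub_left, CStarModule.inner_sub_right, hS.symm]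
  convert h using 1 <;> abel

/-- With `T = 1 - S`, each step `T^j x ↦ T^(j+1) x` lowers `⟨y, y⟩` by at least `⟨y, S y⟩`, and `⟨y,
S y⟩` itself decreases; telescoping leaves `k` copies of the smallest term. -/
theorem inner_pow_add_le (hS : IsPosContraction A S) (k : ℕ) (x : V) :
    inner A (((1 - S) ^ k) x) (((1 - S) ^ k) x) +
      k • inner A (((1 - S) ^ k) x) (S (((1 - S) ^ k) x)) ≤ inner A x x := by
  induction k with
  | zero => simp
  | succ k ih =>
    rw [pow_succ', Module.End.mul_apply]
    set y := ((1 - S) ^ k) x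
    calc inner A (y - S y) (y - S y) + (k + 1) • inner A (y - S y) (S (y - S y))
        ≤ inner A (y - S y) (y - S y) + (k + 1) • inner A y (S y) := by
          gcongr
          exact hS.inner_sub_map_map_le y
      _ = (inner A (y - S y) (y - S y) + inner A y (S y)) + k • inner A y (S y) := by
          rw [succ_nsmul]; abel
      _ ≤ inner A y y + k • inner A y (S y) := by
          gcongr
          exact hS.inner_sub_map_self_le y
      _ ≤ _ := ih

theorem norm_inner_pow_le (hS : IsPosContraction A S) (k : ℕ) (x : V) :
    k * ‖inner A (((1 - S) ^ k) x) (S (((1 - S) ^ k) x))‖ ≤ ‖x‖ ^ 2 := by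
  rw [norm_sq_eq A, ← nsmul_eq_mul, ← RCLike.norm_nsmul ℂ]
  exact CStarAlgebra.norm_le_norm_of_nonneg_of_le (nsmul_nonneg (hS.nonneg _) k)
    ((le_add_of_nonneg_left CStarModule.inner_self_nonneg).trans (hS.inner_pow_add_le k x))

theorem inner_pow_symm (hS : IsPosContraction A S) (k : ℕ) (x y : V) :
    inner A (((1 - S) ^ k) x) y = inner A x (((1 - S) ^ k) y) := by
  induction k generalizing x y with
  | zero => simp
  | succ k ih =>
    rw [pow_succ', Module.End.mul_apply, ← pow_succ', pow_succ, Module.End.mul_apply, ← ih]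
    simp [hS.symm]

theorem exists_inner_eq_sub_pow (hS : IsPosContraction A S) (f : V →L[A] A)
    (hf : ∃ u, ∀ x, f (S x) = inner A u x) (k : ℕ) :
    ∃ u, ∀ x, f x - f (((1 - S) ^ k) x) = inner A u x := by
  obtain ⟨u, hu⟩ := hf
  induction k with
  | zero => exact ⟨0, by simp⟩
  | succ k ih =>
    obtain ⟨v, hv⟩ := ih
    -- With `T = 1 - S`: `f (T^k x) - f (T^(k+1) x) = f (S T^k x) = ⟨u, T^k x⟩ = ⟨T^k u, x⟩`.
    refine ⟨v + ((1 - S) ^ k) u, fun x => ?_⟩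
    rw [CStarModule.inner_add_left, ← hv, hS.inner_pow_symm, ← hu, pow_succ', Module.End.mul_apply,
      LinearMap.sub_apply, Module.End.one_apply, map_sub]
    abel

end IsPosContraction

/-- A functional that is a uniform limit on the unit ball of functionals `⟨u, ·⟩` is itself of
this form. -/
theorem exists_inner_eq_of_tendsto [CompleteSpace V] (f : V →L[A] A) (u : ℕ → V) (ε : ℕ → ℝ)
    (hε : Tendsto ε atTop (𝓝 0)) (hu : ∀ k x, ‖f x - inner A (u k) x‖ ≤ ε k * ‖x‖) :
    ∃ v, ∀ x, f x = inner A v x := by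
  have hdist : ∀ k l, dist (u k) (u l) ≤ |ε k| + |ε l| := fun k l => by
    rw [dist_eq_norm]
    -- Testing on the difference itself turns the functional estimate into a norm estimate.
    set x := u k - u l with hx
    rcases eq_or_ne x 0 with h | h
    · rw [h, norm_zero]; positivity
    · refine le_of_mul_le_mul_right ?_ (norm_pos_iff.2 h)
      calc ‖x‖ * ‖x‖ = ‖inner A x x‖ := by rw [← sq, norm_sq_eq A]
        _ = ‖(f x - inner A (u l) x) - (f x - inner A (u k) x)‖ := by
          congr 1
          conv_lhs => rw [hx, CStarModule.inner_sub_left, ← hx]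
          abel
        _ ≤ ε l * ‖x‖ + ε k * ‖x‖ := (norm_sub_le _ _).trans (add_le_add (hu l x) (hu k x))
        _ ≤ (|ε k| + |ε l|) * ‖x‖ := by
          rw [add_mul, add_comm]
          gcongr <;> exact le_abs_self _
  have habs : Tendsto (fun k => |ε k|) atTop (𝓝 0) := by simpa using hε.abs
  have hcauchy : CauchySeq u := by
    refine Metric.cauchySeq_iff'.2 fun δ hδ => ?_
    obtain ⟨N, hN⟩ := eventually_atTop.1 (habs.eventually_lt_const (half_pos hδ))
    exact ⟨N, fun n hn => (hdist n N).trans_lt (by linarith [hN n hn, hN N le_rfl])⟩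
  obtain ⟨v, hv⟩ := cauchySeq_tendsto_of_complete hcauchy
  refine ⟨v, fun x => ?_⟩
  have h₁ : Tendsto (fun k => inner A (u k) x) atTop (𝓝 (inner A v x)) :=
    (CStarModule.continuous_inner.tendsto (v, x)).comp (hv.prodMk_nhds tendsto_const_nhds)
  have h₂ : Tendsto (fun k => inner A (u k) x) atTop (𝓝 (f x)) := by
    refine tendsto_iff_norm_sub_tendsto_zero.2
      (squeeze_zero (fun _ => norm_nonneg _) (fun k => ?_) (by simpa using hε.mul_const ‖x‖))
    rw [norm_sub_rev]
    exact hu k x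
  exact tendsto_nhds_unique h₂ h₁

/-- A functional `f` that is dominated by the form `⟨x, S x⟩` of a positive contraction `S` such
that `f ∘ S` is represented by an element of `V` is itself represented by an element of `V`. -/
theorem IsPosContraction.exists_inner_eq [CompleteSpace V] {S : V →ₗ[ℂ] V}
    (hS : IsPosContraction A S) (f : V →L[A] A) (hf : ∃ u, ∀ x, f (S x) = inner A u x) (D : ℝ)
    (hD : 0 ≤ D) (hbound : ∀ x, ‖f x‖ ^ 2 ≤ D * ‖inner A x (S x)‖) :
    ∃ v, ∀ x, f x = inner A v x := by
  choose u hu using hS.exists_inner_eq_sub_pow f hf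
  -- The shift to `k + 1` keeps the `1 / k` rate meaningful at index zero.
  refine exists_inner_eq_of_tendsto f (fun k => u (k + 1)) (fun k => √(D * (1 / ((k : ℝ) + 1))))
    ?_ fun k x => ?_
  · simpa using (tendsto_one_div_add_atTop_nhds_zero_nat.const_mul D).sqrt
  · rw [← hu, sub_sub_cancel]
    refine le_of_sq_le_sq ?_ (by positivity)
    rw [mul_pow, Real.sq_sqrt (by positivity), mul_assoc]
    refine (hbound _).trans (mul_le_mul_of_nonneg_left ?_ hD)
    have h := hS.norm_inner_pow_le (k + 1) x
    push_cast at h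
    rw [one_div, inv_mul_eq_div, le_div_iff₀ (by positivity), mul_comm]
    exact h

variable (A) in
/-- The operator `x ↦ c ∑ z ∈ s, ⟨z, x⟩ z`. -/
noncomputable def finiteRank (s : Finset V) (c : ℝ) : V →ₗ[ℂ] V where
  toFun x := (c : ℂ) • ∑ z ∈ s, inner A z x • z
  map_add' x y := by simp [add_smul, Finset.sum_add_distrib]
  map_smul' a x := by
    have h : ∀ (b : A) (z : V), (a • b) • z = a • b • z := fun b z => by
      rw [← smul_one_smul_eq A V a, ← mul_smul, smul_one_mul]
    simp [h, ← Finset.smul_sum, smul_comm (c : ℂ) a]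

theorem inner_finiteRank (s : Finset V) (c : ℝ) (x y : V) :
    inner A x (finiteRank A s c y) = (c : ℂ) • ∑ z ∈ s, inner A z y * inner A x z := by
  simp [finiteRank]

theorem inner_finiteRank_self (s : Finset V) (c : ℝ) (x : V) :
    inner A x (finiteRank A s c x) = c • ∑ z ∈ s, inner A z x * star (inner A z x) := by
  rw [inner_finiteRank]
  simp

/-- The upper bound is Cauchy–Schwarz in each summand. -/
theorem isPosContraction_finiteRank (s : Finset V) {c : ℝ} (hc : 0 ≤ c)
    (hcs : c * ∑ z ∈ s, ‖z‖ ^ 2 ≤ 1) : IsPosContraction A (finiteRank A s c) where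
  symm x y := by
    rw [inner_finiteRank, ← star_inner, inner_finiteRank]
    simp
  nonneg x := by
    rw [inner_finiteRank_self]
    exact smul_nonneg hc (Finset.sum_nonneg fun z _ => mul_star_self_nonneg _)
  le_inner_self x := by
    rw [inner_finiteRank_self]
    calc c • ∑ z ∈ s, inner A z x * star (inner A z x)
        ≤ c • ∑ z ∈ s, ‖z‖ ^ 2 • inner A x x := by
          refine smul_le_smul_of_nonneg_left (Finset.sum_le_sum fun z _ => ?_) hc
          rw [star_inner]
          exact inner_mul_inner_swap_le
      _ = (c * ∑ z ∈ s, ‖z‖ ^ 2) • inner A x x := by rw [← Finset.sum_smul, mul_smul]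
      _ ≤ (1 : ℝ) • inner A x x := smul_le_smul_of_nonneg_right hcs inner_self_nonneg
      _ = inner A x x := one_smul _ _

theorem exists_map_finiteRank_eq_inner (s : Finset V) (c : ℝ) (f : V →L[A] A) :
    ∃ u, ∀ x, f (finiteRank A s c x) = inner A u x := by
  -- `f (⟨z, x⟩ z) = ⟨z, x⟩ f z = ⟨(f z)* z, x⟩`.
  refine ⟨(c : ℂ) • ∑ z ∈ s, star (f z) • z, fun x => ?_⟩
  have h : f (finiteRank A s c x) = (c : ℂ) • f (∑ z ∈ s, inner A z x • z) :=
    (toComplexLinear f).map_smul _ _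
  rw [h]
  simp

/-- Each `⟨z, x⟩⟨z, x⟩*` is dominated by the whole sum of positive terms, and the norm is monotone
on positive elements. -/
theorem sq_hatSeminorms_sup_le (s : Finset V) {c : ℝ} (hc : 0 < c) (x : V) :
    s.sup (hatSeminorms A V) x ^ 2 ≤ c⁻¹ * ‖inner A x (finiteRank A s c x)‖ := by
  rw [← Real.le_sqrt (apply_nonneg _ _) (by positivity)]
  refine Seminorm.finset_sup_apply_le (Real.sqrt_nonneg _) fun z hz => ?_
  rw [Real.le_sqrt (apply_nonneg _ _) (by positivity), inner_finiteRank_self, norm_smul,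
    Real.norm_of_nonneg hc.le, inv_mul_cancel_left₀ hc.ne', sq]
  change ‖inner A z x‖ * ‖inner A z x‖ ≤ _
  rw [← CStarRing.norm_self_mul_star]
  exact CStarAlgebra.norm_le_norm_of_nonneg_of_le (mul_star_self_nonneg _)
    (Finset.single_le_sum (f := fun z => inner A z x * star (inner A z x))
      (fun z _ => mul_star_self_nonneg _) hz)

/-- A functional dominated by finitely many seminorms `‖⟨z, ·⟩‖` is of the form `⟨v, ·⟩`. -/
theorem exists_inner_eq_of_le_sup [CompleteSpace V] (f : V →L[A] A) (s : Finset V) (C : ℝ)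
    (hC : ∀ x, ‖f x‖ ≤ C * s.sup (hatSeminorms A V) x) : ∃ v, ∀ x, f x = inner A v x := by
  have hK : 0 ≤ ∑ z ∈ s, ‖z‖ ^ 2 := Finset.sum_nonneg fun z _ => sq_nonneg _
  set K := ∑ z ∈ s, ‖z‖ ^ 2 with hK_def
  -- `K + 1` rather than `K`, since `K` may vanish.
  have hc : 0 < (K + 1)⁻¹ := by positivity
  refine (isPosContraction_finiteRank s hc.le ?_).exists_inner_eq f
    (exists_map_finiteRank_eq_inner s _ f) (C ^ 2 * (K + 1)⁻¹⁻¹) (by positivity) fun x => ?_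
  · rw [← hK_def, inv_mul_le_one₀ (by positivity)]
    linarith
  · calc ‖f x‖ ^ 2 ≤ (C * s.sup (hatSeminorms A V) x) ^ 2 := by
          gcongr
          exact hC x
      _ ≤ _ := by
          rw [mul_pow, mul_assoc]
          exact mul_le_mul_of_nonneg_left (sq_hatSeminorms_sup_le s hc x) (sq_nonneg C)

end

end HilbertCStar

theorem mainTheorem6 (A V : Type*) [CStarAlgebra A] [PartialOrder A] [StarOrderedRing A]
    [NormedAddCommGroup V] [NormedSpace ℂ V] [Module A V] [CStarModule A V] [CompleteSpace V]
    (hgen : HilbertCStar.IsCountablyGenerated A V)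
    (htop : HilbertCStar.tauHat A V = HilbertCStar.tauDual A V) :
    HilbertCStar.IsSelfDual A V := by
  intro f
  obtain ⟨s, C, hC⟩ := HilbertCStar.exists_bound_of_tauHat_eq_tauDual htop f
  obtain ⟨v, hv⟩ := HilbertCStar.exists_inner_eq_of_le_sup f s C hC
  exact ⟨v, ContinuousLinearMap.ext fun x => (hv x).symm⟩
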